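/- **Setting.** Let $T\ge 1$, and consider the linear system $x_{t+1}=Ax_t+Bu_t$ with $x_t\in\mathbb R^{d_x}$, $u_t\in\mathbb R^{d_u}$, the polytopes $X=\{x: A_x x\le b_x\}$, $U=\{u: A_u u\le b_u\}$, and the model predictive control (MPC) problem of minimizing $\sum_{t=1}^T x_t^\top Q_t x_t+\sum_{t=0}^{T-1}u_t^\top R_t u_t$ subject to $x_t\in X$ for $1\le t\le T$ and $u_t\in U$ for $0\le t\le T-1$, where all $Q_t,R_t$ are positive definite. Let $\widehat A$ be the block column with blocks $A,\dots,A^T$ and $\widehat B$ the block lower triangular matrix with $(t,s)$ block $A^{t-s}B$ for $s\le t$, so that $x_{1:T}=\widehat A x_0+\widehat B u$ for $u=u_{0:T-1}$; let $\mathbf Q,\mathbf R$ be the block diagonal matrices of the $Q_t$, $R_t$, and let $\mathbf A_x,\mathbf A_u$ be the block diagonal matrices with $T$ copies of $A_x$, $A_u$. Up to a term independent of $u$, the MPC problem is: minimize $V(x_0,u)=\tfrac12u^\top Hu-x_0^\top Fu$ subject to $Gu\le w+Px_0$, where $$H=2(\mathbf R+\widehat B^\top \mathbf Q\widehat B),\quad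 F=-2\widehat A^\top \mathbf Q\widehat B,\quad G=\begin{bmatrix}\mathbf A_u\\ \mathbf A_x\widehat B\end{bmatrix},\quad P=\begin{bmatrix}0\\-\mathbf A_x\widehat A\end{bmatrix},\quad w=\begin{bmatrix}(b_u)_{t}\\ (b_x)_{t}\end{bmatrix}$$ ($b_u$ and $b_x$ each repeated $T$ times). Each of the $m$ inequalities may be multiplied by a positive number (the rows of $G,P,w$ below are the rescaled ones); assume the scaling is such that every row of $G$ that is not zero has Euclidean norm at least $1$ (for instance exactly $1$). Write $\phi(x_0,u)=w+Px_0-Gu$ for the residuals and $K(x_0)=\{u:\phi(x_0,u)\ge0\}$. For $\eta>0$ the barrier solution $u_\eta(x_0)$ is the minimizer, over all $u$ with $\phi(x_0,u)>0$, of $$V^\eta(x_0,u)=\tfrac12u^\top Hu-x_0^\top Fu-\eta\Big[\sum_{i=1}^m\log\phi_i(x_0,u)-d^\top u\Big],\qquad d=\nabla_u\sum_{i=1}^m\log\phi_i(0,u)\Big|_{u=0},$$ and the barrier MPC policy $\pi^\eta(x_0)$ is the first input $u_0$ of $u_\eta(x_0)$. For $\sigma\subseteq\{1,\dots,m\}$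 let $[M]_\sigma$ be the principal submatrix of $M$ on $\sigma$ and $M_\sigma^{-1}$ its inverse padded with zeros to the size of $M$. With $\|\cdot\|$ the Euclidean and the spectral norm, put $S=\{\sigma:\det[GH^{-1}G^\top]_\sigma>0\}$, $$K_\sigma=H^{-1}\big[F^\top-G^\top(GH^{-1}G^\top)_\sigma^{-1}(GH^{-1}F^\top-P)\big],\quad L=\max_{\sigma\in S}\|K_\sigma\|,\quad C=\max_{\sigma\in S}\|2H^{-1}G^\top(GH^{-1}G^\top)_\sigma^{-1}\|.$$ **Theorem.** Let $D\subseteq\mathbb R^{d_x}$ be a convex set of initial states (for instance $D=X$), and let $r>0$, $R$, $L_V\ge 0$ be such that for every $x_0\in D$: there is a $u$ with $\phi(x_0,u)>0$ (componentwise); $K(x_0)$ contains a ball of radius $r$ and is contained in the ball of radius $R$ centered at the origin; and $V(x_0,\cdot)$ is $L_V$-Lipschitz on $K(x_0)$. Put $$\nu=20(m+R^2\|d\|^2),\qquad \mathrm{res}_{\mathrm{lb}}=\min\Big\{\frac{\eta}{2},\ \frac{r\eta^2}{150\,(\nu\eta^2+R^2(L_V^2+1))}\Big\}.$$ Then for every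 $x_0\in D$ the minimizer $u_\eta(x_0)$ exists and is unique, $\phi_i(x_0,u_\eta(x_0))\ge\mathrm{res}_{\mathrm{lb}}$ for every $i$ for which the $i$-th row of $G$ is not zero, $u_\eta$ is twice continuously differentiable at $x_0$, and $$\Big\|\frac{\partial^2u_\eta}{\partial x_0^2}(x_0)\Big\|\le\frac{C}{\mathrm{res}_{\mathrm{lb}}}\,(\|P\|+\|G\|L)^2 .$$ Consequently $\pi^\eta$ is $(L_0,L_1)$-smooth on $D$ with $L_0=L$ and $L_1=\frac{C}{\mathrm{res}_{\mathrm{lb}}}(\|P\|+\|G\|L)^2$: it is differentiable at every point of $D$, and $\|\pi^\eta(x)-\pi^\eta(y)\|\le L_0\|x-y\|$ and $\|\partial_x\pi^\eta(x)-\partial_x\pi^\eta(y)\|\le L_1\|x-y\|$ for all $x,y\in D$. (If $Td_u=0$, quotients with denominator $0$ are read as $0$.) -/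

import Mathlib

open scoped Matrix Matrix.Norms.L2Operator NNReal

noncomputable section

/-- Data of the parametric quadratic program in `u ∈ ℝ^n` with parameter `x ∈ ℝ^p`:
minimize `½ uᵀ H u - xᵀ F u` subject to `G u ≤ w + P x` (rows indexed by `ι`). -/
structure ParamQP (n p ι : Type) where
  H : Matrix n n ℝ
  F : Matrix p n ℝ
  G : Matrix ι n ℝ
  P : Matrix ι p ℝ
  w : ι → ℝ

/-- `[M]_σ`: the principal submatrix with rows and columns in `σ`. -/
def principalSub {ι : Type} (M : Matrix ι ι ℝ) (σ : Finset ι) : Matrix σ σ ℝ :=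
  M.submatrix (fun i => (i : ι)) (fun i => (i : ι))

/-- `M_σ⁻¹`: the inverse of `[M]_σ`, padded with zeros back to the size of `M`. -/
def paddedInv {ι : Type} [DecidableEq ι] (M : Matrix ι ι ℝ) (σ : Finset ι) : Matrix ι ι ℝ :=
  Matrix.of fun i j =>
    if h : i ∈ σ ∧ j ∈ σ then (principalSub M σ)⁻¹ ⟨i, h.1⟩ ⟨j, h.2⟩ else 0

namespace ParamQP

section Problem

variable {n p ι : Type} [Fintype n] [Fintype p] [Fintype ι]

/-- The objective `½ uᵀ H u - xᵀ F u`. -/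
def objective (q : ParamQP n p ι) (x : EuclideanSpace ℝ p) (u : EuclideanSpace ℝ n) : ℝ :=
  1 / 2 * (u.ofLp ⬝ᵥ (q.H *ᵥ u.ofLp)) - x.ofLp ⬝ᵥ (q.F *ᵥ u.ofLp)

/-- The residual `φ_i(x, u)` of the `i`-th constraint. -/
def residual (q : ParamQP n p ι) (x : EuclideanSpace ℝ p) (u : EuclideanSpace ℝ n) (i : ι) : ℝ :=
  q.w i + (q.P *ᵥ x.ofLp) i - (q.G *ᵥ u.ofLp) i

/-- The constraint polytope for the parameter `x`. -/
def feasible (q : ParamQP n p ι) (x : EuclideanSpace ℝ p) : Set (EuclideanSpace ℝ n) :=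
  {u | ∀ i, 0 ≤ q.residual x u i}

/-- The domain of the log-barrier: all residuals are positive. -/
def strictlyFeasible (q : ParamQP n p ι) (x : EuclideanSpace ℝ p) :
    Set (EuclideanSpace ℝ n) :=
  {u | ∀ i, 0 < q.residual x u i}

/-- The recentering vector `d = ∇_u ∑ i, log (φ_i(0, u))` at `u = 0`. -/
def recenter (q : ParamQP n p ι) : EuclideanSpace ℝ n :=
  gradient (fun u => ∑ i, Real.log (q.residual 0 u i)) 0

/-- The barrier cost `V^η(x, u)`. -/
def barrierCost (q : ParamQP n p ι) (η : ℝ) (x : EuclideanSpace ℝ p)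
    (u : EuclideanSpace ℝ n) : ℝ :=
  q.objective x u - η * (∑ i, Real.log (q.residual x u i) - inner ℝ q.recenter u)

/-- `u` minimizes `V^η(x, ·)` over the domain of the barrier. -/
def IsBarrierMinimizer (q : ParamQP n p ι) (η : ℝ) (x : EuclideanSpace ℝ p)
    (u : EuclideanSpace ℝ n) : Prop :=
  u ∈ q.strictlyFeasible x ∧ ∀ v ∈ q.strictlyFeasible x, q.barrierCost η x u ≤ q.barrierCost η x v

/-- The barrier solution `u_η(x)`: the minimizer of `V^η(x, ·)`. -/
def barrierSol (q : ParamQP n p ι) (η : ℝ) (x : EuclideanSpace ℝ p) : EuclideanSpace ℝ n :=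
  Classical.epsilon fun u => q.IsBarrierMinimizer η x u

end Problem

section Constants

variable {n p ι : Type} [Fintype n] [DecidableEq n] [Fintype ι] [DecidableEq ι]

/-- `G H⁻¹ Gᵀ`. -/
def gram (q : ParamQP n p ι) : Matrix ι ι ℝ := q.G * q.H⁻¹ * q.Gᵀ

open Classical in
/-- The family `S` of the sets `σ` of constraints with `det [G H⁻¹ Gᵀ]_σ > 0`. -/
def activeSets (q : ParamQP n p ι) : Finset (Finset ι) :=
  Finset.univ.filter fun σ => 0 < (principalSub q.gram σ).det

theorem activeSets_nonempty (q : ParamQP n p ι) : q.activeSets.Nonempty :=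
  ⟨∅, by simp [activeSets, Matrix.det_isEmpty]⟩

variable [Fintype p] [DecidableEq p]

/-- The gain `K_σ = H⁻¹ [Fᵀ - Gᵀ (G H⁻¹ Gᵀ)_σ⁻¹ (G H⁻¹ Fᵀ - P)]`. -/
def gain (q : ParamQP n p ι) (σ : Finset ι) : Matrix n p ℝ :=
  q.H⁻¹ * (q.Fᵀ - q.Gᵀ * paddedInv q.gram σ * (q.G * q.H⁻¹ * q.Fᵀ - q.P))

/-- `L = max_{σ ∈ S} ‖K_σ‖` (spectral norms). -/
def constL (q : ParamQP n p ι) : ℝ :=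
  q.activeSets.sup' q.activeSets_nonempty fun σ => ‖q.gain σ‖

/-- `C = max_{σ ∈ S} ‖2 H⁻¹ Gᵀ (G H⁻¹ Gᵀ)_σ⁻¹‖` (spectral norms). -/
def constC (q : ParamQP n p ι) : ℝ :=
  q.activeSets.sup' q.activeSets_nonempty fun σ =>
    ‖(2 : ℝ) • (q.H⁻¹ * q.Gᵀ * paddedInv q.gram σ)‖

/-- `ν = 20 (m + R² ‖d‖²)`, with `m` the number of constraints. -/
def nu (q : ParamQP n p ι) (R : ℝ) : ℝ :=
  20 * ((Fintype.card ι : ℝ) + R ^ 2 * ‖q.recenter‖ ^ 2)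

/-- `min {η / 2, r η² / (150 (ν η² + R² (L_V² + 1)))}`. -/
def resLB (q : ParamQP n p ι) (η r R LV : ℝ) : ℝ :=
  min (η / 2) (r * η ^ 2 / (150 * (q.nu R * η ^ 2 + R ^ 2 * (LV ^ 2 + 1))))

end Constants

end ParamQP

/-- Linear MPC with horizon `T`: dynamics `x_{t+1} = A x_t + B u_t`, stage cost
`∑_{t=1}^T x_tᵀ Q_t x_t + ∑_{t=0}^{T-1} u_tᵀ R_t u_t`, constraints `Ax x_t ≤ bx` for
`1 ≤ t ≤ T` and `Au u_t ≤ bu` for `0 ≤ t ≤ T - 1`. Here `Q t` is the weight of `x_{t+1}`. -/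
structure LinearMPC (T dx du kx ku : ℕ) where
  A : Matrix (Fin dx) (Fin dx) ℝ
  B : Matrix (Fin dx) (Fin du) ℝ
  Q : Fin T → Matrix (Fin dx) (Fin dx) ℝ
  R : Fin T → Matrix (Fin du) (Fin du) ℝ
  Ax : Matrix (Fin kx) (Fin dx) ℝ
  bx : Fin kx → ℝ
  Au : Matrix (Fin ku) (Fin du) ℝ
  bu : Fin ku → ℝ
  Q_posDef : ∀ t, (Q t).PosDef
  R_posDef : ∀ t, (R t).PosDef

namespace LinearMPC

variable {T dx du kx ku : ℕ}

/-- The index set of the `T (ku + kx)` constraints; stacked objects are indexed by pairs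
(component, time). -/
abbrev Constr (T kx ku : ℕ) : Type := (Fin ku × Fin T) ⊕ (Fin kx × Fin T)

/-- `Â`, the block column of `A, …, A^T`. -/
def Ahat (M : LinearMPC T dx du kx ku) : Matrix (Fin dx × Fin T) (Fin dx) ℝ :=
  Matrix.of fun i j => (M.A ^ ((i.2 : ℕ) + 1)) i.1 j

/-- `B̂`, block lower triangular with blocks `A^(t-s) B`, so that `x_{1:T} = Â x_0 + B̂ u`. -/
def Bhat (M : LinearMPC T dx du kx ku) : Matrix (Fin dx × Fin T) (Fin du × Fin T) ℝ :=
  Matrix.of fun i j => if j.2 ≤ i.2 then (M.A ^ ((i.2 : ℕ) - (j.2 : ℕ)) * M.B) i.1 j.1 else 0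

/-- The condensed quadratic program in `u = u_{0:T-1}`. Its objective is the MPC cost up to a term
that does not depend on `u`; the `i`-th inequality is multiplied by `s i`. -/
def condensed (M : LinearMPC T dx du kx ku) (s : Constr T kx ku → ℝ) :
    ParamQP (Fin du × Fin T) (Fin dx) (Constr T kx ku) where
  H := (2 : ℝ) • (Matrix.blockDiagonal M.R + M.Bhatᵀ * Matrix.blockDiagonal M.Q * M.Bhat)
  F := -((2 : ℝ) • (M.Ahatᵀ * Matrix.blockDiagonal M.Q * M.Bhat))
  G := Matrix.diagonal s *
    Matrix.fromRows (Matrix.blockDiagonal fun _ : Fin T => M.Au)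
      ((Matrix.blockDiagonal fun _ : Fin T => M.Ax) * M.Bhat)
  P := Matrix.diagonal s *
    Matrix.fromRows 0 (-((Matrix.blockDiagonal fun _ : Fin T => M.Ax) * M.Ahat))
  w := fun i => s i * Sum.elim (fun j => M.bu j.1) (fun j => M.bx j.1) i

/-- The barrier MPC policy: the first input `u_0` of the barrier solution. -/
def barrierPolicy [NeZero T] (M : LinearMPC T dx du kx ku) (s : Constr T kx ku → ℝ) (η : ℝ)
    (x : EuclideanSpace ℝ (Fin dx)) : EuclideanSpace ℝ (Fin du) :=
  WithLp.toLp 2 fun j => (M.condensed s).barrierSol η x (j, 0)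

end LinearMPC

/-- `π` is `(L₀, L₁)`-smooth on `D`. -/
def IsSmoothPolicyOn {dx du : ℕ} (D : Set (EuclideanSpace ℝ (Fin dx)))
    (π : EuclideanSpace ℝ (Fin dx) → EuclideanSpace ℝ (Fin du)) (L₀ L₁ : ℝ) : Prop :=
  (∀ x ∈ D, DifferentiableAt ℝ π x) ∧
  ∀ x ∈ D, ∀ y ∈ D, ‖π x - π y‖ ≤ L₀ * ‖x - y‖ ∧ ‖fderiv ℝ π x - fderiv ℝ π y‖ ≤ L₁ * ‖x - y‖

end

/-! Write `φ` for the residuals at the barrier solution. Stationarity of the barrier cost is a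
smooth equation in `(x, u)` whose `u`-derivative is `H + Gᵀ W G`, with `W` the diagonal matrix of
the `η / φ_i²`. This matrix is invertible, so the implicit function theorem makes the solution `C²`.
Differentiating once and twice gives linear systems with the same matrix: the right-hand side is `Fᵀ
z + Gᵀ W P z` for the first derivative and `Gᵀ W v` for the second, where `v_i` is `-2 / φ_i` times
the product of the directional derivatives of `φ_i`.

The difficulty is to invert `H + Gᵀ W G` with bounds independent of `W`, whose entries blow up near
the boundary. Eliminating `u` leaves `Gᵀ (G H⁻¹ Gᵀ + W⁻¹)⁻¹`. Expanding determinant and adjugate in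
powers of the diagonal `W⁻¹` shows that this is a convex combination of the matrices `Gᵀ (G H⁻¹
Gᵀ)_σ⁻¹` with `σ ∈ S` (`exists_convex_weights`); the weights are normalized principal minors. Hence
the first derivative is a convex combination of the gains `K_σ`, bounded by `L`, and the second is
bounded by `C ‖v‖ / 2` (`norm_le_constL`, `two_mul_norm_le_constC`).

What remains is a lower bound for `φ_i`, to control `v`. It comes from testing stationarity in the
direction of the center of the inscribed ball (`resLB_le_residual`). The mean value inequality on
the convex set `D` then turns the derivative bounds into Lipschitz bounds. -/

noncomputable section

/-! ### Principal minor expansions of the determinant and the adjugate -/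

section PrincipalMinors

variable {ι : Type} [Fintype ι] [DecidableEq ι]

/-- This is one term of the row-multilinear expansion of `det (A + diagonal d)`. The rows outside
`σ` are diagonal, so the matrix is block triangular with respect to membership in `σ`. -/
theorem det_piecewise_diagonal (d : ι → ℝ) (A : Matrix ι ι ℝ) (σ : Finset ι) :
    Matrix.det (Matrix.of (σ.piecewise A (Matrix.diagonal d))) = (∏ i ∈ σᶜ, d i) * (principalSub A σ).det := by
  rw [Matrix.twoBlockTriangular_det _ (fun i => i ∈ σ), mul_comm]
  · congr 1
    · have : Matrix.toSquareBlockProp (Matrix.of (σ.piecewise A (Matrix.diagonal d))) (fun i => i ∉ σ)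
          = Matrix.diagonal fun i : {i // i ∉ σ} => d i := by
        ext i j
        simp [Matrix.toSquareBlockProp, Matrix.diagonal_apply, Finset.piecewise, i.2,
          Subtype.ext_iff]
      rw [this, Matrix.det_diagonal]
      exact Finset.prod_subtype _ (fun i => by simp) _ |>.symm
    · have : Matrix.toSquareBlockProp (Matrix.of (σ.piecewise A (Matrix.diagonal d)))
          (fun i => i ∈ σ) = principalSub A σ := by
        ext i j
        have hi : (i : ι) ∈ σ := i.2
        simp [Matrix.toSquareBlockProp, principalSub, Finset.piecewise, hi]
      rw [this]
      convert rfl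
  · intro i hi j hj
    have : i ≠ j := fun h => hi (h ▸ hj)
    simp [Finset.piecewise, hi, this]

/-- Expansion of `det (A + D)`, with `D` diagonal, in the principal minors of `A`. -/
theorem det_add_diagonal_eq_sum (d : ι → ℝ) (A : Matrix ι ι ℝ) :
    (A + Matrix.diagonal d).det = ∑ σ, (∏ i ∈ σᶜ, d i) * (principalSub A σ).det := by
  have h := (Matrix.detRowAlternating (n := ι) (R := ℝ)).toMultilinearMap.map_add_univ
    A (Matrix.diagonal d)
  refine h.trans (Finset.sum_congr rfl fun σ _ => det_piecewise_diagonal d A σ)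

/-- The adjugate of `[M]_σ`, padded with zeros. -/
def paddedAdj (M : Matrix ι ι ℝ) (σ : Finset ι) : Matrix ι ι ℝ :=
  Matrix.of fun i j =>
    if h : i ∈ σ ∧ j ∈ σ then (principalSub M σ).adjugate ⟨i, h.1⟩ ⟨j, h.2⟩ else 0

theorem adjugate_add_diagonal_eq_sum (d : ι → ℝ) (A : Matrix ι ι ℝ) :
    (A + Matrix.diagonal d).adjugate = ∑ σ, (∏ i ∈ σᶜ, d i) • paddedAdj A σ := by
  ext i j
  -- An adjugate entry is a determinant with row `j` replaced. Replacing the row in `A` and setting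
  -- `d j` to `0` reduces it to the determinant expansion, in which only the sets `σ` containing `j`
  -- survive.
  have h1 : (A + Matrix.diagonal d).updateRow j (Pi.single i 1)
      = A.updateRow j (Pi.single i 1) + Matrix.diagonal (Function.update d j 0) := by
    ext k l
    by_cases hk : k = j
    · subst hk
      by_cases hl : k = l
      · subst hl; simp
      · simp [hl]
    · by_cases hl : k = l
      · subst hl; simp [hk]
      · simp [hk, hl]
  rw [Matrix.adjugate_apply, h1, det_add_diagonal_eq_sum, Matrix.sum_apply]
  refine Finset.sum_congr rfl fun σ _ => ?_
  rw [Matrix.smul_apply, smul_eq_mul]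
  by_cases hj : j ∈ σ
  · congr 1
    · refine Finset.prod_congr rfl fun k hk => ?_
      rw [Function.update_of_ne]
      rintro rfl
      exact (Finset.mem_compl.1 hk) hj
    · by_cases hi : i ∈ σ
      · rw [paddedAdj, Matrix.of_apply, dif_pos ⟨hi, hj⟩, Matrix.adjugate_apply]
        congr 1
        ext k l
        by_cases hk : k = ⟨j, hj⟩
        · subst hk
          simp [principalSub, Pi.single_apply, Subtype.ext_iff]
        · have hk' : (k : ι) ≠ j := fun h => hk (Subtype.ext h)
          simp [principalSub, hk, hk']
      · rw [paddedAdj, Matrix.of_apply, dif_neg (fun h => hi h.1)]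
        refine Matrix.det_eq_zero_of_row_eq_zero ⟨j, hj⟩ fun l => ?_
        have : (l : ι) ≠ i := fun h => hi (h ▸ l.2)
        simp [principalSub, this]
  · rw [Finset.prod_eq_zero (Finset.mem_compl.2 hj) (by simp), paddedAdj, Matrix.of_apply,
      dif_neg (fun h => hj h.2)]
    simp

end PrincipalMinors

namespace ParamQP

/-! ### Convex combinations over the sets of `S` -/

section Weights

variable {n p ι : Type} [Fintype n] [DecidableEq n] [Fintype ι] [DecidableEq ι]

omit [DecidableEq ι] in
theorem gram_posSemidef (q : ParamQP n p ι) (hH : q.H.PosDef) : q.gram.PosSemidef := by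
  simpa [gram] using hH.inv.posSemidef.mul_mul_conjTranspose_same q.G

omit [DecidableEq ι] in
theorem principalSub_gram_posSemidef (q : ParamQP n p ι) (hH : q.H.PosDef) (σ : Finset ι) :
    (principalSub q.gram σ).PosSemidef :=
  (q.gram_posSemidef hH).submatrix _

/-- If the minor on `σ` vanishes, the adjugate itself need not, but each column `v` of its padding
is supported on `σ` and satisfies `(G H⁻¹ Gᵀ v)_i = 0` for `i ∈ σ`. Thus `(Gᵀ v)ᵀ H⁻¹ (Gᵀ v) = 0`,
and `Gᵀ v = 0` because `H⁻¹` is positive definite. The factor `Gᵀ` therefore removes every set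
outside `S`. -/
theorem transpose_mul_paddedAdj (q : ParamQP n p ι) (hH : q.H.PosDef) (σ : Finset ι) :
    q.Gᵀ * paddedAdj q.gram σ
      = (principalSub q.gram σ).det • (q.Gᵀ * paddedInv q.gram σ) := by
  by_cases hdet : (principalSub q.gram σ).det = 0
  · rw [hdet, zero_smul]
    ext k j
    by_cases hj : j ∈ σ
    swap
    · simp [Matrix.mul_apply, paddedAdj, hj]
    set v : ι → ℝ := fun i => paddedAdj q.gram σ i j with hv
    have hvσ : ∀ i ∉ σ, v i = 0 := fun i hi => by simp [hv, paddedAdj, hi]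
    have hker : ∀ i ∈ σ, (q.gram *ᵥ v) i = 0 := by
      intro i hi
      have h := congrFun (congrFun (Matrix.mul_adjugate (principalSub q.gram σ)) ⟨i, hi⟩) ⟨j, hj⟩
      rw [hdet, zero_smul, Matrix.zero_apply, Matrix.mul_apply] at h
      rw [← h, Matrix.mulVec, dotProduct, ← Finset.sum_subset (Finset.subset_univ σ)
        (fun l _ hl => by rw [hvσ l hl, mul_zero]), ← Finset.sum_coe_sort σ]
      refine Finset.sum_congr rfl fun l _ => ?_
      simp [hv, paddedAdj, hj, principalSub]
    have hquad : v ⬝ᵥ (q.gram *ᵥ v) = 0 := by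
      refine Finset.sum_eq_zero fun i _ => ?_
      by_cases hi : i ∈ σ
      · rw [hker i hi, mul_zero]
      · rw [hvσ i hi, zero_mul]
    have hz : q.Gᵀ *ᵥ v = 0 := by
      by_contra hne
      have := hH.inv.dotProduct_mulVec_pos hne
      refine this.ne' ?_
      rw [← hquad, gram, star_trivial, ← Matrix.mulVec_mulVec, ← Matrix.mulVec_mulVec,
        Matrix.dotProduct_mulVec v, Matrix.mulVec_transpose]
    exact congrFun hz k
  · rw [← Matrix.mul_smul]
    congr 1
    ext i j
    by_cases h : i ∈ σ ∧ j ∈ σ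
    · simp [paddedAdj, paddedInv, h, Matrix.inv_def, hdet]
    · simp [paddedAdj, paddedInv, h]

/-- `Gᵀ (G H⁻¹ Gᵀ + D)⁻¹`, with `D` diagonal and positive, is a convex combination of the matrices
`Gᵀ (G H⁻¹ Gᵀ)_σ⁻¹` with `σ ∈ S`. -/
theorem exists_convex_weights (q : ParamQP n p ι) (hH : q.H.PosDef) (d : ι → ℝ)
    (hd : ∀ i, 0 < d i) :
    ∃ c : Finset ι → ℝ, (∀ σ, 0 ≤ c σ) ∧ ∑ σ ∈ q.activeSets, c σ = 1 ∧
      q.Gᵀ * (q.gram + Matrix.diagonal d)⁻¹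
        = ∑ σ ∈ q.activeSets, c σ • (q.Gᵀ * paddedInv q.gram σ) := by
  have hpos : 0 < (q.gram + Matrix.diagonal d).det :=
    ((Matrix.PosDef.diagonal hd).posSemidef_add (q.gram_posSemidef hH)).det_pos
  set δ := (q.gram + Matrix.diagonal d).det with hδ
  have hsub : ∀ σ ∉ q.activeSets, (principalSub q.gram σ).det = 0 := by
    intro σ hσ
    refine le_antisymm (not_lt.1 fun h => hσ ?_) (q.principalSub_gram_posSemidef hH σ).det_nonneg
    simpa [activeSets] using h
  -- The weights are the terms of the expansion of `δ`, divided by `δ`; hence they sum to one.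
  refine ⟨fun σ => δ⁻¹ * ((∏ i ∈ σᶜ, d i) * (principalSub q.gram σ).det), fun σ => ?_, ?_, ?_⟩
  · have h1 : 0 ≤ ∏ i ∈ σᶜ, d i := Finset.prod_nonneg fun i _ => (hd i).le
    have h2 := (q.principalSub_gram_posSemidef hH σ).det_nonneg
    positivity
  · rw [← Finset.mul_sum, Finset.sum_subset (Finset.subset_univ _)
      (fun σ _ hσ => by rw [hsub σ hσ, mul_zero]), ← det_add_diagonal_eq_sum, inv_mul_cancel₀]
    exact hpos.ne'
  · rw [Matrix.inv_def, adjugate_add_diagonal_eq_sum, Ring.inverse_eq_inv', ← hδ,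
      Finset.sum_subset (Finset.subset_univ q.activeSets)
      (fun σ _ hσ => by simp only [hsub σ hσ, mul_zero, zero_smul]), Finset.smul_sum,
      Matrix.mul_sum]
    refine Finset.sum_congr rfl fun σ _ => ?_
    rw [Matrix.mul_smul, Matrix.mul_smul, transpose_mul_paddedAdj q hH, smul_smul, smul_smul,
      mul_assoc]

/-- The solution of `(H + Gᵀ W G) u = f + Gᵀ W v`, with `W` diagonal and positive, is a convex
combination of the solutions of the equality constrained problems on the sets `σ ∈ S`. -/
theorem exists_convex_weights_solution (q : ParamQP n p ι) (hH : q.H.PosDef) (W : ι → ℝ)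
    (hW : ∀ i, 0 < W i) :
    ∃ c : Finset ι → ℝ, (∀ σ, 0 ≤ c σ) ∧ ∑ σ ∈ q.activeSets, c σ = 1 ∧
      ∀ (u f : n → ℝ) (v : ι → ℝ),
        q.H *ᵥ u = f + q.Gᵀ *ᵥ (fun i => W i * (v i - (q.G *ᵥ u) i)) →
        u = ∑ σ ∈ q.activeSets, c σ •
          (q.H⁻¹ *ᵥ (f - q.Gᵀ *ᵥ (paddedInv q.gram σ *ᵥ (q.G *ᵥ (q.H⁻¹ *ᵥ f) - v)))) := by
  obtain ⟨c, hc0, hc1, hc⟩ := q.exists_convex_weights hH (fun i => (W i)⁻¹)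
    (fun i => inv_pos.2 (hW i))
  refine ⟨c, hc0, hc1, fun u f v h => ?_⟩
  have hHu : IsUnit q.H.det := (Matrix.isUnit_iff_isUnit_det _).1 hH.isUnit
  set y : ι → ℝ := fun i => W i * (v i - (q.G *ᵥ u) i) with hy
  have hDpos : (q.gram + Matrix.diagonal fun i => (W i)⁻¹).PosDef :=
    (Matrix.PosDef.diagonal fun i => inv_pos.2 (hW i)).posSemidef_add (q.gram_posSemidef hH)
  have hu : u = q.H⁻¹ *ᵥ (f + q.Gᵀ *ᵥ y) := by
    rw [← h, Matrix.mulVec_mulVec, Matrix.nonsing_inv_mul _ hHu, Matrix.one_mulVec]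
  -- Taking the multiplier `y = W (v - G u)` as the unknown moves the large weights `W` into the
  -- diagonal perturbation `W⁻¹` of the Gram matrix.
  have hDy : (q.gram + Matrix.diagonal fun i => (W i)⁻¹) *ᵥ y = v - q.G *ᵥ (q.H⁻¹ *ᵥ f) := by
    have h1 : (Matrix.diagonal fun i => (W i)⁻¹) *ᵥ y = v - q.G *ᵥ u := by
      ext i
      rw [Matrix.mulVec_diagonal, hy, inv_mul_cancel_left₀ (hW i).ne', Pi.sub_apply]
    have h2 : q.gram *ᵥ y = q.G *ᵥ (q.H⁻¹ *ᵥ (q.Gᵀ *ᵥ y)) := by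
      simp [gram, Matrix.mulVec_mulVec, Matrix.mul_assoc]
    rw [Matrix.add_mulVec, h1, h2]
    conv_lhs => rw [hu]
    rw [Matrix.mulVec_add, Matrix.mulVec_add]
    abel
  have hGy : q.Gᵀ *ᵥ y = (q.Gᵀ * (q.gram + Matrix.diagonal fun i => (W i)⁻¹)⁻¹) *ᵥ
      (v - q.G *ᵥ (q.H⁻¹ *ᵥ f)) := by
    rw [← hDy, Matrix.mulVec_mulVec, Matrix.mul_assoc, Matrix.nonsing_inv_mul _
      ((Matrix.isUnit_iff_isUnit_det _).1 hDpos.isUnit), Matrix.mul_one]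
  rw [hu, hGy, hc]
  have hf : f = ∑ σ ∈ q.activeSets, c σ • f := by rw [← Finset.sum_smul, hc1, one_smul]
  have hterm : ∀ σ : Finset ι,
      c σ • (q.H⁻¹ *ᵥ (f - q.Gᵀ *ᵥ (paddedInv q.gram σ *ᵥ (q.G *ᵥ (q.H⁻¹ *ᵥ f) - v))))
        = q.H⁻¹ *ᵥ (c σ • f
          + (c σ • (q.Gᵀ * paddedInv q.gram σ)) *ᵥ (v - q.G *ᵥ (q.H⁻¹ *ᵥ f))) := by
    intro σ
    rw [← Matrix.mulVec_smul, Matrix.smul_mulVec, ← smul_add, ← neg_sub v, Matrix.mulVec_neg,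
      Matrix.mulVec_neg, sub_neg_eq_add, Matrix.mulVec_mulVec]
  simp_rw [hterm]
  rw [← Matrix.mulVec_sum, Finset.sum_add_distrib, ← hf, Matrix.sum_mulVec]

end Weights

end ParamQP

namespace ParamQP

/-! ### Bounds by `C` and `L` for the weighted linear systems -/

section NormBounds

variable {n p ι : Type} [Fintype n] [DecidableEq n] [Fintype ι] [DecidableEq ι]

theorem norm_convex_combination_le {E : Type*} [NormedAddCommGroup E] [NormedSpace ℝ E]
    {α : Type*} {s : Finset α} {c : α → ℝ} {f : α → E} {B : ℝ} (hc : ∀ a, 0 ≤ c a)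
    (hc1 : ∑ a ∈ s, c a = 1) (hf : ∀ a ∈ s, ‖f a‖ ≤ B) : ‖∑ a ∈ s, c a • f a‖ ≤ B := by
  calc ‖∑ a ∈ s, c a • f a‖ ≤ ∑ a ∈ s, c a * B := by
        refine norm_sum_le_of_le _ fun a ha => ?_
        rw [norm_smul, Real.norm_of_nonneg (hc a)]
        exact mul_le_mul_of_nonneg_left (hf a ha) (hc a)
    _ = B := by rw [← Finset.sum_mul, hc1, one_mul]

theorem constC_nonneg (q : ParamQP n p ι) : 0 ≤ q.constC := by
  obtain ⟨σ, hσ⟩ := q.activeSets_nonempty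
  exact (norm_nonneg _).trans
    (Finset.le_sup' (fun σ => ‖(2 : ℝ) • (q.H⁻¹ * q.Gᵀ * paddedInv q.gram σ)‖) hσ)

theorem two_mul_norm_le_constC (q : ParamQP n p ι) (hH : q.H.PosDef) {W : ι → ℝ}
    (hW : ∀ i, 0 < W i) (u : EuclideanSpace ℝ n) (v : EuclideanSpace ℝ ι)
    (h : q.H *ᵥ u.ofLp = q.Gᵀ *ᵥ (fun i => W i * (v i - (q.G *ᵥ u.ofLp) i))) :
    2 * ‖u‖ ≤ q.constC * ‖v‖ := by
  obtain ⟨c, hc0, hc1, hc⟩ := q.exists_convex_weights_solution hH W hW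
  have hu := hc u.ofLp 0 v.ofLp (by rw [zero_add]; exact h)
  have hu' : (2 : ℝ) • u = ∑ σ ∈ q.activeSets, c σ •
      WithLp.toLp 2 (((2 : ℝ) • (q.H⁻¹ * q.Gᵀ * paddedInv q.gram σ)) *ᵥ v.ofLp) := by
    apply (WithLp.linearEquiv 2 ℝ (n → ℝ)).injective
    rw [map_smul, map_sum]
    change (2 : ℝ) • u.ofLp = _
    rw [hu, Finset.smul_sum]
    refine Finset.sum_congr rfl fun σ _ => ?_
    rw [map_smul, smul_comm]
    congr 1
    simp [Matrix.smul_mulVec, Matrix.mulVec_mulVec, Matrix.mulVec_neg, Matrix.mul_assoc]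
  have h2 : ‖(2 : ℝ) • u‖ = 2 * ‖u‖ := by simp [norm_smul]
  rw [← h2, hu']
  refine norm_convex_combination_le hc0 hc1 fun σ hσ => ?_
  refine (Matrix.l2_opNorm_mulVec _ v).trans (mul_le_mul_of_nonneg_right ?_ (norm_nonneg _))
  exact Finset.le_sup' (fun σ => ‖(2 : ℝ) • (q.H⁻¹ * q.Gᵀ * paddedInv q.gram σ)‖) hσ

variable [Fintype p] [DecidableEq p]

theorem constL_nonneg (q : ParamQP n p ι) : 0 ≤ q.constL := by
  obtain ⟨σ, hσ⟩ := q.activeSets_nonempty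
  exact (norm_nonneg _).trans (Finset.le_sup' (fun σ => ‖q.gain σ‖) hσ)

theorem norm_le_constL (q : ParamQP n p ι) (hH : q.H.PosDef) {W : ι → ℝ} (hW : ∀ i, 0 < W i)
    (u : EuclideanSpace ℝ n) (z : EuclideanSpace ℝ p)
    (h : q.H *ᵥ u.ofLp = q.Fᵀ *ᵥ z.ofLp +
      q.Gᵀ *ᵥ (fun i => W i * ((q.P *ᵥ z.ofLp) i - (q.G *ᵥ u.ofLp) i))) :
    ‖u‖ ≤ q.constL * ‖z‖ := by
  obtain ⟨c, hc0, hc1, hc⟩ := q.exists_convex_weights_solution hH W hW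
  have hu := hc _ _ _ h
  have hu' : u = ∑ σ ∈ q.activeSets, c σ • WithLp.toLp 2 (q.gain σ *ᵥ z.ofLp) := by
    apply (WithLp.linearEquiv 2 ℝ (n → ℝ)).injective
    rw [map_sum]
    change u.ofLp = _
    rw [hu]
    refine Finset.sum_congr rfl fun σ _ => ?_
    rw [map_smul]
    congr 1
    simp [gain, Matrix.sub_mulVec, ← Matrix.mulVec_mulVec]
  rw [hu']
  refine norm_convex_combination_le hc0 hc1 fun σ hσ => ?_
  refine (Matrix.l2_opNorm_mulVec _ z).trans (mul_le_mul_of_nonneg_right ?_ (norm_nonneg _))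
  exact Finset.le_sup' (fun σ => ‖q.gain σ‖) hσ

end NormBounds

/-! ### Existence, uniqueness and stationarity of the barrier minimizer -/

section Barrier

variable {n p ι : Type} [Fintype n] [Fintype p] [Fintype ι]

/-- The gradient of the barrier cost with respect to `u`. -/
def gradCost (q : ParamQP n p ι) (η : ℝ) (x : EuclideanSpace ℝ p) (u : EuclideanSpace ℝ n) :
    n → ℝ :=
  q.H *ᵥ u.ofLp - q.Fᵀ *ᵥ x.ofLp +
    η • (q.Gᵀ *ᵥ (fun i => (q.residual x u i)⁻¹) + q.recenter.ofLp)

omit [Fintype ι] in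
theorem residual_add (q : ParamQP n p ι) (x : EuclideanSpace ℝ p) (u v : EuclideanSpace ℝ n)
    (i : ι) : q.residual x (u + v) i = q.residual x u i - (q.G *ᵥ v.ofLp) i := by
  simp only [residual, WithLp.ofLp_add, Matrix.mulVec_add, Pi.add_apply]
  ring

omit [Fintype ι] in
theorem objective_add (q : ParamQP n p ι) (hH : q.H.IsHermitian) (x : EuclideanSpace ℝ p)
    (u v : EuclideanSpace ℝ n) :
    q.objective x (u + v) = q.objective x u + (q.H *ᵥ u.ofLp - q.Fᵀ *ᵥ x.ofLp) ⬝ᵥ v.ofLp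
      + 1 / 2 * (v.ofLp ⬝ᵥ (q.H *ᵥ v.ofLp)) := by
  have hT : q.Hᵀ = q.H := by simpa using hH.eq
  have h1 : u.ofLp ⬝ᵥ (q.H *ᵥ v.ofLp) = (q.H *ᵥ u.ofLp) ⬝ᵥ v.ofLp := by
    rw [Matrix.dotProduct_mulVec, ← Matrix.mulVec_transpose, hT]
  have h2 : v.ofLp ⬝ᵥ (q.H *ᵥ u.ofLp) = (q.H *ᵥ u.ofLp) ⬝ᵥ v.ofLp := dotProduct_comm _ _
  have h3 : x.ofLp ⬝ᵥ (q.F *ᵥ v.ofLp) = (q.Fᵀ *ᵥ x.ofLp) ⬝ᵥ v.ofLp := by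
    rw [Matrix.dotProduct_mulVec, ← Matrix.mulVec_transpose]
  simp only [objective, WithLp.ofLp_add, Matrix.mulVec_add, dotProduct_add, add_dotProduct,
    sub_dotProduct, h1, h2, h3]
  ring

theorem transpose_mulVec_inv_dotProduct (q : ParamQP n p ι) (x : EuclideanSpace ℝ p)
    (u v : EuclideanSpace ℝ n) :
    (q.Gᵀ *ᵥ (fun i => (q.residual x u i)⁻¹)) ⬝ᵥ v.ofLp
      = ∑ i, (q.G *ᵥ v.ofLp) i / q.residual x u i := by
  rw [Matrix.mulVec_transpose, ← Matrix.dotProduct_mulVec, dotProduct]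
  exact Finset.sum_congr rfl fun i _ => by rw [div_eq_inv_mul]

theorem gradCost_dotProduct (q : ParamQP n p ι) (η : ℝ) (x : EuclideanSpace ℝ p)
    (u v : EuclideanSpace ℝ n) :
    q.gradCost η x u ⬝ᵥ v.ofLp = (q.H *ᵥ u.ofLp - q.Fᵀ *ᵥ x.ofLp) ⬝ᵥ v.ofLp
      + η * (∑ i, (q.G *ᵥ v.ofLp) i / q.residual x u i + inner ℝ q.recenter v) := by
  rw [gradCost, add_dotProduct, smul_dotProduct, smul_eq_mul, add_dotProduct,
    transpose_mulVec_inv_dotProduct]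
  congr 3
  simp [EuclideanSpace.inner_eq_star_dotProduct, dotProduct_comm]

/-- Strong convexity of the barrier cost: the quadratic part is exact, and each logarithm lies below
its tangent by `log t ≤ t - 1`. -/
theorem barrierCost_add_ge (q : ParamQP n p ι) (hH : q.H.IsHermitian) {η : ℝ} (hη : 0 < η)
    {x : EuclideanSpace ℝ p} {u v : EuclideanSpace ℝ n} (hu : u ∈ q.strictlyFeasible x)
    (hv : u + v ∈ q.strictlyFeasible x) :
    q.barrierCost η x u + q.gradCost η x u ⬝ᵥ v.ofLp + 1 / 2 * (v.ofLp ⬝ᵥ (q.H *ᵥ v.ofLp))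
      ≤ q.barrierCost η x (u + v) := by
  have hlog : ∑ i, Real.log (q.residual x (u + v) i) ≤ ∑ i, Real.log (q.residual x u i)
      - ∑ i, (q.G *ᵥ v.ofLp) i / q.residual x u i := by
    rw [← Finset.sum_sub_distrib]
    refine Finset.sum_le_sum fun i _ => ?_
    have h0 := hu i
    have h1 := Real.log_le_sub_one_of_pos (div_pos (hv i) h0)
    rw [Real.log_div (hv i).ne' h0.ne'] at h1
    have h2 : q.residual x (u + v) i / q.residual x u i - 1
        = - ((q.G *ᵥ v.ofLp) i / q.residual x u i) := by
      rw [residual_add]; field_simp; ring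
    linarith
  rw [gradCost_dotProduct, barrierCost, barrierCost, objective_add q hH, inner_add_right]
  nlinarith [mul_le_mul_of_nonneg_left hlog hη.le]

theorem IsBarrierMinimizer.of_gradCost_eq_zero {q : ParamQP n p ι} (hH : q.H.PosDef) {η : ℝ}
    (hη : 0 < η) {x : EuclideanSpace ℝ p} {u : EuclideanSpace ℝ n}
    (hu : u ∈ q.strictlyFeasible x) (hg : q.gradCost η x u = 0) :
    q.IsBarrierMinimizer η x u ∧ ∀ v, q.IsBarrierMinimizer η x v → v = u := by
  have key : ∀ v ∈ q.strictlyFeasible x, q.barrierCost η x u +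
      1 / 2 * ((v - u).ofLp ⬝ᵥ (q.H *ᵥ (v - u).ofLp)) ≤ q.barrierCost η x v := by
    intro v hv
    have h := q.barrierCost_add_ge hH.isHermitian hη (v := v - u) hu (by simpa using hv)
    rw [hg, zero_dotProduct, add_zero, add_sub_cancel] at h
    exact h
  refine ⟨⟨hu, fun v hv => ?_⟩, fun v hv => ?_⟩
  · have h0 := hH.posSemidef.dotProduct_mulVec_nonneg (v - u).ofLp
    rw [star_trivial] at h0
    linarith [key v hv]
  · by_contra hne
    have h0 := hH.dotProduct_mulVec_pos (x := (v - u).ofLp)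
      (fun h => hne (sub_eq_zero.1 (WithLp.ofLp_injective 2 h)))
    rw [star_trivial] at h0
    linarith [key v hv.1, hv.2 u hu]

omit [Fintype ι] in
theorem continuous_residual (q : ParamQP n p ι) (i : ι) :
    Continuous fun z : EuclideanSpace ℝ p × EuclideanSpace ℝ n => q.residual z.1 z.2 i := by
  unfold residual Matrix.mulVec dotProduct
  fun_prop

omit [Fintype ι] in
theorem continuous_residual_right (q : ParamQP n p ι) (x : EuclideanSpace ℝ p) (i : ι) :
    Continuous fun u : EuclideanSpace ℝ n => q.residual x u i :=
  (q.continuous_residual i).comp (by fun_prop : Continuous fun u => (x, u))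

omit [Fintype ι] in
theorem continuous_objective (q : ParamQP n p ι) (x : EuclideanSpace ℝ p) :
    Continuous (q.objective x) := by
  unfold objective Matrix.mulVec dotProduct
  fun_prop

theorem exists_isBarrierMinimizer (q : ParamQP n p ι) {η : ℝ} (hη : 0 < η)
    {x : EuclideanSpace ℝ p} (hne : (q.strictlyFeasible x).Nonempty)
    (hb : Bornology.IsBounded (q.feasible x)) : ∃ u, q.IsBarrierMinimizer η x u := by
  have hclosed : IsClosed (q.feasible x) := by
    simp only [feasible, Set.ofPred_forall]
    exact isClosed_iInter fun i => isClosed_le continuous_const (q.continuous_residual_right x i)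
  have hcomp : IsCompact (q.feasible x) := Metric.isCompact_of_isClosed_isBounded hclosed hb
  -- On the strict interior `ψ = exp (-V^η / η)`. Unlike the cost, it is continuous on the whole
  -- compact polytope, and it vanishes where some residual does, so its maximizer is strictly
  -- feasible.
  set ψ : EuclideanSpace ℝ n → ℝ := fun u =>
    Real.exp (-(q.objective x u + η * inner ℝ q.recenter u) / η) * ∏ i, q.residual x u i with hψ
  have hcont : Continuous ψ := by
    have h1 := q.continuous_objective x
    have h2 := q.continuous_residual_right x
    fun_prop
  obtain ⟨u₀, hu₀⟩ := hne
  obtain ⟨u, hu, hmax⟩ := hcomp.exists_isMaxOn ⟨u₀, fun i => (hu₀ i).le⟩ hcont.continuousOn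
  have hψpos : ∀ v ∈ q.strictlyFeasible x, 0 < ψ v := fun v hv =>
    mul_pos (Real.exp_pos _) (Finset.prod_pos fun i _ => hv i)
  have hus : u ∈ q.strictlyFeasible x := by
    have h0 : 0 < ψ u := (hψpos u₀ hu₀).trans_le (hmax fun i => (hu₀ i).le)
    intro i
    refine lt_of_le_of_ne (hu i) fun h => h0.ne' ?_
    rw [hψ]
    simp only
    rw [Finset.prod_eq_zero (Finset.mem_univ i) h.symm, mul_zero]
  have hlog : ∀ v ∈ q.strictlyFeasible x, q.barrierCost η x v = -η * Real.log (ψ v) := by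
    intro v hv
    rw [hψ]
    simp only
    rw [Real.log_mul (Real.exp_pos _).ne' (Finset.prod_pos fun i _ => hv i).ne', Real.log_exp,
      Real.log_prod (fun i _ => (hv i).ne'), barrierCost]
    field_simp
    ring
  refine ⟨u, hus, fun v hv => ?_⟩
  rw [hlog u hus, hlog v hv]
  have := Real.log_le_log (hψpos v hv) (hmax fun i => (hv i).le)
  nlinarith

theorem eventually_strictlyFeasible (q : ParamQP n p ι) {x : EuclideanSpace ℝ p}
    {u : EuclideanSpace ℝ n} (hu : u ∈ q.strictlyFeasible x) :
    ∀ᶠ z in nhds (x, u), z.2 ∈ q.strictlyFeasible z.1 :=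
  Filter.eventually_all.2 fun i =>
    (q.continuous_residual i).continuousAt.eventually (lt_mem_nhds (hu i))

theorem IsBarrierMinimizer.gradCost_eq_zero {q : ParamQP n p ι} (hH : q.H.IsHermitian) {η : ℝ}
    {x : EuclideanSpace ℝ p} {u : EuclideanSpace ℝ n} (hu : q.IsBarrierMinimizer η x u) :
    q.gradCost η x u = 0 := by
  have key : ∀ v : EuclideanSpace ℝ n, q.gradCost η x u ⬝ᵥ v.ofLp = 0 := by
    intro v
    have hline : Filter.Tendsto (fun t : ℝ => (x, u + t • v)) (nhds 0) (nhds (x, u)) := by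
      have : Continuous (fun t : ℝ => (x, u + t • v)) := by fun_prop
      simpa using this.tendsto 0
    have hmin : IsLocalMin (fun t : ℝ => q.barrierCost η x (u + t • v)) 0 := by
      filter_upwards [hline.eventually (q.eventually_strictlyFeasible hu.1)] with t ht
      simpa using hu.2 _ ht
    have hres : ∀ i, HasDerivAt (fun t : ℝ => Real.log (q.residual x (u + t • v) i))
        (-(q.G *ᵥ v.ofLp) i / q.residual x u i) 0 := by
      intro i
      have h1 : HasDerivAt (fun t : ℝ => q.residual x (u + t • v) i) (-(q.G *ᵥ v.ofLp) i) 0 := by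
        have h2 : (fun t : ℝ => q.residual x (u + t • v) i)
            = fun t => q.residual x u i - t * (q.G *ᵥ v.ofLp) i := by
          ext t
          rw [residual_add, WithLp.ofLp_smul, Matrix.mulVec_smul, Pi.smul_apply, smul_eq_mul]
        rw [h2]
        simpa using ((hasDerivAt_id (0 : ℝ)).mul_const ((q.G *ᵥ v.ofLp) i)).const_sub
          (q.residual x u i)
      have h3 := h1.log (by simpa using (hu.1 i).ne')
      simpa using h3
    have hobj : HasDerivAt (fun t : ℝ => q.objective x (u + t • v))
        ((q.H *ᵥ u.ofLp - q.Fᵀ *ᵥ x.ofLp) ⬝ᵥ v.ofLp) 0 := by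
      have h2 : (fun t : ℝ => q.objective x (u + t • v))
          = fun t => q.objective x u + t * ((q.H *ᵥ u.ofLp - q.Fᵀ *ᵥ x.ofLp) ⬝ᵥ v.ofLp)
            + t ^ 2 * (1 / 2 * (v.ofLp ⬝ᵥ (q.H *ᵥ v.ofLp))) := by
        ext t
        rw [objective_add q hH, WithLp.ofLp_smul, Matrix.mulVec_smul, dotProduct_smul,
          dotProduct_smul, smul_dotProduct]
        simp only [smul_eq_mul]
        ring
      rw [h2]
      have h3 := ((hasDerivAt_id (0 : ℝ)).mul_const
        ((q.H *ᵥ u.ofLp - q.Fᵀ *ᵥ x.ofLp) ⬝ᵥ v.ofLp)).const_add (q.objective x u)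
      have h4 := (hasDerivAt_pow 2 (0 : ℝ)).mul_const (1 / 2 * (v.ofLp ⬝ᵥ (q.H *ᵥ v.ofLp)))
      simpa using h3.fun_add h4
    have hinner : HasDerivAt (fun t : ℝ => inner ℝ q.recenter (u + t • v))
        (inner ℝ q.recenter v) 0 := by
      simp_rw [inner_add_right, inner_smul_right]
      simpa using ((hasDerivAt_id (0 : ℝ)).mul_const (inner ℝ q.recenter v)).const_add
        (inner ℝ q.recenter u)
    have hcost := hobj.sub (((HasDerivAt.fun_sum fun i (_ : i ∈ Finset.univ) => hres i).sub
      hinner).const_mul η)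
    have h0 := hmin.hasDerivAt_eq_zero hcost
    rw [gradCost_dotProduct, ← h0]
    simp only [neg_div, Finset.sum_neg_distrib]
    ring
  have := key (WithLp.toLp 2 (q.gradCost η x u))
  exact dotProduct_self_eq_zero.1 this

theorem barrierSol_eq_of_gradCost_eq_zero {q : ParamQP n p ι} (hH : q.H.PosDef) {η : ℝ}
    (hη : 0 < η) {x : EuclideanSpace ℝ p} {u : EuclideanSpace ℝ n}
    (hu : u ∈ q.strictlyFeasible x) (hg : q.gradCost η x u = 0) : q.barrierSol η x = u := by
  obtain ⟨h1, h2⟩ := IsBarrierMinimizer.of_gradCost_eq_zero hH hη hu hg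
  exact h2 _ (Classical.epsilon_spec (p := fun u => q.IsBarrierMinimizer η x u) ⟨u, h1⟩)

end Barrier

end ParamQP

namespace ParamQP

/-! ### Lower bound for the residuals -/

section ResidualBound

variable {n p ι : Type} [Fintype n] [Fintype p] [Fintype ι]

omit [Fintype ι] in
-- The point at distance `r` from the center along the normalized row is still feasible, and getting
-- there costs `r` times the row norm.
theorem mul_norm_row_le_residual (q : ParamQP n p ι) {x : EuclideanSpace ℝ p}
    {c : EuclideanSpace ℝ n} {r : ℝ} (hr : 0 ≤ r)
    (hc : Metric.closedBall c r ⊆ q.feasible x) (i : ι) :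
    r * ‖WithLp.toLp 2 (q.G i)‖ ≤ q.residual x c i := by
  set g : EuclideanSpace ℝ n := WithLp.toLp 2 (q.G i) with hg
  rcases eq_or_ne g 0 with h0 | h0
  · rw [h0, norm_zero, mul_zero]
    exact hc (Metric.mem_closedBall_self hr) i
  · have hgn : 0 < ‖g‖ := norm_pos_iff.2 h0
    have hmem : c + (r / ‖g‖) • g ∈ Metric.closedBall c r := by
      rw [mem_closedBall_iff_norm, add_sub_cancel_left, norm_smul, Real.norm_of_nonneg
        (by positivity), div_mul_cancel₀ _ hgn.ne']
    have h1 := hc hmem i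
    have h2 : (q.G *ᵥ g.ofLp) i = ‖g‖ ^ 2 := by
      rw [EuclideanSpace.norm_sq_eq]
      simp [Matrix.mulVec, dotProduct, hg, sq]
    rw [residual_add, WithLp.ofLp_smul, Matrix.mulVec_smul, Pi.smul_apply, h2, smul_eq_mul] at h1
    have h3 : r / ‖g‖ * ‖g‖ ^ 2 = r * ‖g‖ := by field_simp
    linarith

theorem resLB_le_residual (q : ParamQP n p ι) (hH : q.H.PosDef) {η r R : ℝ} {LV : ℝ≥0}
    (hη : 0 < η) (hr : 0 < r) {x : EuclideanSpace ℝ p} {c u : EuclideanSpace ℝ n}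
    (hc : Metric.closedBall c r ⊆ q.feasible x) (hR : q.feasible x ⊆ Metric.closedBall 0 R)
    (hLip : LipschitzOnWith LV (q.objective x) (q.feasible x))
    (hu : u ∈ q.strictlyFeasible x) (hg : q.gradCost η x u = 0) {i : ι}
    (hi : 1 ≤ ‖WithLp.toLp 2 (q.G i)‖) : q.resLB η r R LV ≤ q.residual x u i := by
  have huK : u ∈ q.feasible x := fun j => (hu j).le
  have hcK : c ∈ q.feasible x := hc (Metric.mem_closedBall_self hr.le)
  have huR : ‖u‖ ≤ R := mem_closedBall_zero_iff.1 (hR huK)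
  have hcR : ‖c‖ ≤ R := mem_closedBall_zero_iff.1 (hR hcK)
  have hR0 : 0 ≤ R := (norm_nonneg u).trans huR
  have hLV : (0 : ℝ) ≤ LV := LV.2
  -- Stationarity is tested in the direction from the minimizer to the center of the ball. The
  -- barrier part then contains `∑ φ_j(c) / φ_j(u)`, which is large if some `φ_i(u)` is small, while
  -- all other terms are bounded.
  set v := c - u with hv
  have hvR : ‖v‖ ≤ 2 * R := (norm_sub_le c u).trans (by linarith)
  have hcv : c = u + v := by rw [hv, add_sub_cancel]
  -- By convexity the directional derivative of the objective is at most its increment from `u` to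
  -- `c`, which the Lipschitz constant controls.
  have hobj : (q.H *ᵥ u.ofLp - q.Fᵀ *ᵥ x.ofLp) ⬝ᵥ v.ofLp ≤ LV * (2 * R) := by
    have h1 := q.objective_add hH.isHermitian x u v
    have h2 := hH.posSemidef.dotProduct_mulVec_nonneg v.ofLp
    rw [star_trivial] at h2
    have h3 := hLip.dist_le_mul c hcK u huK
    rw [Real.dist_eq, dist_eq_norm, ← hv] at h3
    have h4 := le_abs_self (q.objective x c - q.objective x u)
    rw [← hcv] at h1
    have h5 := mul_le_mul_of_nonneg_left hvR hLV
    linarith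
  have hd : inner ℝ q.recenter v ≤ ‖q.recenter‖ * (2 * R) :=
    (real_inner_le_norm _ _).trans (mul_le_mul_of_nonneg_left hvR (norm_nonneg _))
  have hsum : ∑ j, (q.G *ᵥ v.ofLp) j / q.residual x u j
      = Fintype.card ι - ∑ j, q.residual x c j / q.residual x u j := by
    rw [← nsmul_one, ← Finset.card_univ, ← Finset.sum_const, ← Finset.sum_sub_distrib]
    refine Finset.sum_congr rfl fun j _ => ?_
    have hj := (hu j).ne'
    rw [hcv, residual_add]
    field_simp
    ring
  have hstat := q.gradCost_dotProduct η x u v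
  rw [hg, zero_dotProduct, hsum] at hstat
  have hci : r ≤ q.residual x c i := by
    have := q.mul_norm_row_le_residual hr.le hc i
    nlinarith
  have hri : r / q.residual x u i ≤ ∑ j, q.residual x c j / q.residual x u j :=
    (div_le_div_of_nonneg_right hci (hu i).le).trans
      (Finset.single_le_sum (f := fun j => q.residual x c j / q.residual x u j)
        (fun j _ => div_nonneg (hcK j) (hu j).le) (Finset.mem_univ i))
  -- The index `i` witnesses `m ≥ 1`, so the terms `η²` produced below by completing squares are
  -- absorbed in `m η²`.
  have hm : (1 : ℝ) ≤ Fintype.card ι := by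
    exact_mod_cast Fintype.card_pos_iff.2 ⟨i⟩
  set δ := ‖q.recenter‖
  set m : ℝ := ((Fintype.card ι : ℕ) : ℝ) with hm_def
  set ρ := q.residual x u i
  have hρ : 0 < ρ := hu i
  have hmain : η * (r / ρ) ≤ η * m + LV * (2 * R) + η * (δ * (2 * R)) := by
    have h1 := mul_le_mul_of_nonneg_left hri hη.le
    have h2 := mul_le_mul_of_nonneg_left hd hη.le
    linarith
  have hmain' : η * r ≤ (η * m + LV * (2 * R) + η * (δ * (2 * R))) * ρ := by
    rwa [← mul_div_assoc, div_le_iff₀ hρ] at hmain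
  -- The cross terms are split by `2 η L_V R ≤ η² + L_V² R²` and `2 δ R ≤ 1 + δ² R²`; the constants
  -- `150` and `20` leave ample room.
  have hden : η * (η * m + LV * (2 * R) + η * (δ * (2 * R)))
      ≤ 150 * (q.nu R * η ^ 2 + R ^ 2 * ((LV : ℝ) ^ 2 + 1)) := by
    rw [nu, ← hm_def]
    have e1 := sq_nonneg (η - LV * R)
    have e2 := mul_nonneg (sq_nonneg η) (sq_nonneg (1 - δ * R))
    have e3 := mul_le_mul_of_nonneg_left hm (sq_nonneg η)
    have e4 : 0 ≤ η ^ 2 * (δ * R) ^ 2 := by positivity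
    have e5 : 0 ≤ (LV * R : ℝ) ^ 2 := by positivity
    have e6 : 0 ≤ R ^ 2 := by positivity
    nlinarith
  refine (min_le_right _ _).trans (div_le_of_le_mul₀ ?_ hρ.le ?_)
  · have : 0 ≤ q.nu R := by unfold nu; positivity
    positivity
  · calc r * η ^ 2 = η * (η * r) := by ring
      _ ≤ η * ((η * m + LV * (2 * R) + η * (δ * (2 * R))) * ρ) :=
        mul_le_mul_of_nonneg_left hmain' hη.le
      _ = η * (η * m + LV * (2 * R) + η * (δ * (2 * R))) * ρ := by ring
      _ ≤ _ := by rw [mul_comm ρ]; exact mul_le_mul_of_nonneg_right hden hρ.le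

theorem resLB_nonneg (q : ParamQP n p ι) {η r : ℝ} (hη : 0 < η) (hr : 0 < r) (R LV : ℝ) :
    0 ≤ q.resLB η r R LV := by
  have : 0 ≤ q.nu R := by unfold nu; positivity
  exact le_min (by positivity) (by positivity)

theorem resLB_pos [Nonempty ι] (q : ParamQP n p ι) {η r : ℝ} (hη : 0 < η) (hr : 0 < r)
    (R LV : ℝ) : 0 < q.resLB η r R LV := by
  have : 0 < q.nu R := by unfold nu; positivity
  exact lt_min (by positivity) (by positivity)

end ResidualBound

/-! ### Derivatives of the barrier solution and their bounds -/

section Smoothness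

variable {n p ι : Type} [Fintype n] [Fintype p] [Fintype ι]

theorem _root_.HasDerivAt.matrix_mulVec {m k : Type} [Fintype m] [Fintype k] (A : Matrix m k ℝ)
    {f : ℝ → k → ℝ} {f' : k → ℝ} {t : ℝ} (hf : HasDerivAt f f' t) :
    HasDerivAt (fun s => A *ᵥ f s) (A *ᵥ f') t :=
  (LinearMap.toContinuousLinearMap A.mulVecLin).hasFDerivAt.comp_hasDerivAt t hf

theorem _root_.HasDerivAt.ofLp {k : Type} [Fintype k] {f : ℝ → EuclideanSpace ℝ k}
    {f' : EuclideanSpace ℝ k} {t : ℝ} (hf : HasDerivAt f f' t) :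
    HasDerivAt (fun s => (f s).ofLp) f'.ofLp t :=
  (EuclideanSpace.equiv k ℝ : EuclideanSpace ℝ k →L[ℝ] k → ℝ).hasFDerivAt.comp_hasDerivAt t hf

theorem hasDerivAt_residual (q : ParamQP n p ι) {X : ℝ → EuclideanSpace ℝ p}
    {U : ℝ → EuclideanSpace ℝ n} {x' : EuclideanSpace ℝ p} {u' : EuclideanSpace ℝ n} {t : ℝ}
    (hX : HasDerivAt X x' t) (hU : HasDerivAt U u' t) (i : ι) :
    HasDerivAt (fun s => q.residual (X s) (U s) i)
      ((q.P *ᵥ x'.ofLp) i - (q.G *ᵥ u'.ofLp) i) t :=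
  ((hasDerivAt_pi.1 (hX.ofLp.matrix_mulVec q.P) i).const_add _).sub
    (hasDerivAt_pi.1 (hU.ofLp.matrix_mulVec q.G) i)

theorem hasDerivAt_gradCost (q : ParamQP n p ι) (η : ℝ) {X : ℝ → EuclideanSpace ℝ p}
    {U : ℝ → EuclideanSpace ℝ n} {x' : EuclideanSpace ℝ p} {u' : EuclideanSpace ℝ n} {t : ℝ}
    (hX : HasDerivAt X x' t) (hU : HasDerivAt U u' t) (h0 : ∀ i, q.residual (X t) (U t) i ≠ 0) :
    HasDerivAt (fun s => q.gradCost η (X s) (U s))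
      (q.H *ᵥ u'.ofLp - (q.Fᵀ *ᵥ x'.ofLp + q.Gᵀ *ᵥ (fun i => η / q.residual (X t) (U t) i ^ 2 *
        ((q.P *ᵥ x'.ofLp) i - (q.G *ᵥ u'.ofLp) i)))) t := by
  have h1 : HasDerivAt (fun s => (fun i => (q.residual (X s) (U s) i)⁻¹))
      (fun i => -((q.P *ᵥ x'.ofLp) i - (q.G *ᵥ u'.ofLp) i) / q.residual (X t) (U t) i ^ 2) t :=
    hasDerivAt_pi.2 fun i => (q.hasDerivAt_residual hX hU i).fun_inv (h0 i)
  have h2 := (((hU.ofLp.matrix_mulVec q.H).sub (hX.ofLp.matrix_mulVec q.Fᵀ)).add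
    (((h1.matrix_mulVec q.Gᵀ).add_const q.recenter.ofLp).const_smul η))
  refine (show HasDerivAt (fun s => q.gradCost η (X s) (U s)) _ t from h2).congr_deriv ?_
  rw [← sub_sub, sub_eq_add_neg _ (q.Gᵀ *ᵥ _), ← Matrix.mulVec_neg, ← Matrix.mulVec_smul]
  congr 2
  ext i
  simp only [Pi.neg_apply, Pi.smul_apply, smul_eq_mul]
  ring

theorem contDiffAt_gradCost (q : ParamQP n p ι) (η : ℝ) {x : EuclideanSpace ℝ p}
    {u : EuclideanSpace ℝ n} (h0 : ∀ i, q.residual x u i ≠ 0) :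
    ContDiffAt ℝ 2 (fun z : EuclideanSpace ℝ p × EuclideanSpace ℝ n =>
      WithLp.toLp 2 (q.gradCost η z.1 z.2)) (x, u) := by
  have hres : ∀ i, ContDiffAt ℝ 2 (fun z : EuclideanSpace ℝ p × EuclideanSpace ℝ n =>
      (q.residual z.1 z.2 i)⁻¹) (x, u) := by
    intro i
    refine ContDiffAt.inv ?_ (h0 i)
    unfold residual Matrix.mulVec dotProduct
    fun_prop
  rw [contDiffAt_euclidean]
  intro k
  simp only [gradCost, Matrix.mulVec, dotProduct, Pi.add_apply, Pi.sub_apply, Pi.smul_apply]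
  fun_prop

variable [DecidableEq n] [DecidableEq ι]

/-- The parameters for which the barrier problem has a minimizer. -/
def solvable (q : ParamQP n p ι) (η : ℝ) : Set (EuclideanSpace ℝ p) :=
  {x | ∃ u, q.IsBarrierMinimizer η x u}

omit [DecidableEq n] [DecidableEq ι] in
theorem barrierSol_spec {q : ParamQP n p ι} {η : ℝ} {x : EuclideanSpace ℝ p}
    (hx : x ∈ q.solvable η) : q.IsBarrierMinimizer η x (q.barrierSol η x) :=
  Classical.epsilon_spec (p := fun u => q.IsBarrierMinimizer η x u) hx

theorem fderiv_gradCost_comp_inr_isInvertible (q : ParamQP n p ι) (hH : q.H.PosDef) {η : ℝ}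
    (hη : 0 < η) {x : EuclideanSpace ℝ p} {u : EuclideanSpace ℝ n}
    (hu : u ∈ q.strictlyFeasible x) :
    (fderiv ℝ (fun z : EuclideanSpace ℝ p × EuclideanSpace ℝ n =>
      WithLp.toLp 2 (q.gradCost η z.1 z.2)) (x, u) ∘L .inr ℝ _ _).IsInvertible := by
  have h0 : ∀ i, q.residual x u i ≠ 0 := fun i => (hu i).ne'
  set T := fderiv ℝ (fun z : EuclideanSpace ℝ p × EuclideanSpace ℝ n =>
      WithLp.toLp 2 (q.gradCost η z.1 z.2)) (x, u) ∘L .inr ℝ _ _ with hT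
  have hinj : Function.Injective (T : EuclideanSpace ℝ n →ₗ[ℝ] EuclideanSpace ℝ n) := by
    rw [← LinearMap.ker_eq_bot, LinearMap.ker_eq_bot']
    intro v hv
    have hline : HasDerivAt (fun t : ℝ => u + t • v) v 0 := by
      simpa using ((hasDerivAt_id (0 : ℝ)).smul_const v).const_add u
    have hconst : HasDerivAt (fun _ : ℝ => x) 0 0 := hasDerivAt_const _ _
    have h1 := q.hasDerivAt_gradCost η hconst hline (by simpa using h0)
    have hd : HasFDerivAt (fun z : EuclideanSpace ℝ p × EuclideanSpace ℝ n =>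
        WithLp.toLp 2 (q.gradCost η z.1 z.2))
        (fderiv ℝ (fun z : EuclideanSpace ℝ p × EuclideanSpace ℝ n =>
          WithLp.toLp 2 (q.gradCost η z.1 z.2)) (x, u)) (x, u + (0 : ℝ) • v) := by
      rw [zero_smul, add_zero]
      exact ((q.contDiffAt_gradCost η h0).differentiableAt two_ne_zero).hasFDerivAt
    have h2 := (hd.comp_hasDerivAt (0 : ℝ) (hconst.prodMk hline)).ofLp
    have h3 := h1.unique h2
    have h4 : (fderiv ℝ (fun z : EuclideanSpace ℝ p × EuclideanSpace ℝ n =>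
        WithLp.toLp 2 (q.gradCost η z.1 z.2)) (x, u)) (0, v) = 0 := hv
    rw [h4] at h3
    have h6 := sub_eq_zero.1 (h3.trans (WithLp.ofLp_zero 2))
    -- A kernel vector solves the weighted system with zero data, so the bound by `C` forces it to
    -- be zero; in finite dimension injectivity suffices.
    have h5 := q.two_mul_norm_le_constC hH (W := fun i => η / q.residual x u i ^ 2)
      (fun i => div_pos hη (pow_pos (hu i) 2)) v 0 (by
        rw [h6]; simp)
    rw [norm_zero, mul_zero] at h5
    exact norm_le_zero_iff.1 (by linarith)
  refine ⟨(LinearEquiv.ofInjectiveEndo _ hinj).toContinuousLinearEquiv, ?_⟩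
  ext v
  rfl

/-- Near `x` the implicit branch through the minimizer is stationary and stays strictly feasible. By
convexity such a point is the unique minimizer, so the branch coincides with the barrier solution,
and solvability is an open condition. -/
theorem contDiffAt_barrierSol (q : ParamQP n p ι) (hH : q.H.PosDef) {η : ℝ}
    (hη : 0 < η) {x : EuclideanSpace ℝ p} (hx : x ∈ q.solvable η) :
    ContDiffAt ℝ 2 (q.barrierSol η) x ∧ ∀ᶠ y in nhds x, y ∈ q.solvable η := by
  set u := q.barrierSol η x
  have hu := barrierSol_spec hx
  have hg := hu.gradCost_eq_zero hH.isHermitian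
  have hinv := q.fderiv_gradCost_comp_inr_isInvertible hH hη hu.1
  have hcd := q.contDiffAt_gradCost η (fun i => (hu.1 i).ne')
  set ψ := hcd.implicitFunction two_ne_zero hinv
  have hψ : ContDiffAt ℝ 2 ψ x := hcd.contDiffAt_implicitFunction two_ne_zero hinv
  have hψx : ψ x = u := hcd.implicitFunction_apply_self two_ne_zero hinv
  have hψ0 : ∀ᶠ y in nhds x, q.gradCost η y (ψ y) = 0 := by
    filter_upwards [hcd.eventually_apply_implicitFunction two_ne_zero hinv] with y hy
    rw [hg] at hy
    exact (WithLp.toLp_injective 2) hy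
  have htend : Filter.Tendsto (fun y => (y, ψ y)) (nhds x) (nhds (x, u)) := by
    have := (continuousAt_id.prodMk hψ.continuousAt).tendsto
    simpa [hψx] using this
  have hψs : ∀ᶠ y in nhds x, ψ y ∈ q.strictlyFeasible y :=
    htend.eventually (q.eventually_strictlyFeasible hu.1)
  refine ⟨hψ.congr_of_eventuallyEq ?_, ?_⟩
  · filter_upwards [hψ0, hψs] with y h1 h2
    exact barrierSol_eq_of_gradCost_eq_zero hH hη h2 h1
  · filter_upwards [hψ0, hψs] with y h1 h2
    exact ⟨_, (IsBarrierMinimizer.of_gradCost_eq_zero hH hη h2 h1).1⟩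

omit [Fintype n] [DecidableEq n] [Fintype ι] [DecidableEq ι] in
theorem _root_.hasDerivAt_add_smul (x y : EuclideanSpace ℝ p) (t : ℝ) :
    HasDerivAt (fun s : ℝ => x + s • y) y t := by
  simpa using ((hasDerivAt_id t).smul_const y).const_add x

omit [Fintype n] [DecidableEq n] [Fintype ι] [DecidableEq ι] in
theorem _root_.tendsto_add_smul (x y : EuclideanSpace ℝ p) :
    Filter.Tendsto (fun s : ℝ => x + s • y) (nhds 0) (nhds x) := by
  simpa using (hasDerivAt_add_smul x y 0).continuousAt.tendsto

theorem _root_.HasFDerivAt.hasDerivAt_line_apply {E F : Type*} [NormedAddCommGroup E]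
    [NormedSpace ℝ E] [NormedAddCommGroup F] [NormedSpace ℝ F] {g : E → E →L[ℝ] F}
    {g' : E →L[ℝ] E →L[ℝ] F} {x : E} (hg : HasFDerivAt g g' x) (y z : E) :
    HasDerivAt (fun s : ℝ => g (x + s • y) z) (g' y z) 0 := by
  have hX : HasDerivAt (fun s : ℝ => x + s • y) y 0 := by
    simpa using ((hasDerivAt_id (0 : ℝ)).smul_const y).const_add x
  have hg0 : HasFDerivAt g g' (x + (0 : ℝ) • y) := by rwa [zero_smul, add_zero]
  exact (ContinuousLinearMap.apply ℝ F z).hasFDerivAt.comp_hasDerivAt (0 : ℝ)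
    (hg0.comp_hasDerivAt (0 : ℝ) hX)

/-- The linear equation solved by the derivative of the barrier solution. -/
theorem mulVec_fderiv_barrierSol (q : ParamQP n p ι) (hH : q.H.PosDef) {η : ℝ}
    (hη : 0 < η) {x : EuclideanSpace ℝ p} (hx : x ∈ q.solvable η) (z : EuclideanSpace ℝ p) :
    q.H *ᵥ (fderiv ℝ (q.barrierSol η) x z).ofLp = q.Fᵀ *ᵥ z.ofLp +
      q.Gᵀ *ᵥ (fun i => η / q.residual x (q.barrierSol η x) i ^ 2 *
        ((q.P *ᵥ z.ofLp) i - (q.G *ᵥ (fderiv ℝ (q.barrierSol η) x z).ofLp) i)) := by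
  obtain ⟨hcd, hev⟩ := q.contDiffAt_barrierSol hH hη hx
  have hX := hasDerivAt_add_smul x z 0
  have hF : HasFDerivAt (q.barrierSol η) (fderiv ℝ (q.barrierSol η) x) (x + (0 : ℝ) • z) := by
    rw [zero_smul, add_zero]
    exact (hcd.differentiableAt two_ne_zero).hasFDerivAt
  have h1 := q.hasDerivAt_gradCost η hX (hF.comp_hasDerivAt (0 : ℝ) hX)
    (fun i => by simpa using ((barrierSol_spec hx).1 i).ne')
  have h2 : (fun s : ℝ => q.gradCost η (x + s • z) (q.barrierSol η (x + s • z)))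
      =ᶠ[nhds 0] fun _ => 0 := by
    filter_upwards [(tendsto_add_smul x z).eventually hev] with s hs
    exact (barrierSol_spec hs).gradCost_eq_zero hH.isHermitian
  have h3 := h1.unique ((hasDerivAt_const (0 : ℝ) (0 : n → ℝ)).congr_of_eventuallyEq h2)
  simpa [sub_eq_zero] using h3

/-- The linear equation solved by the second derivative of the barrier solution. -/
theorem mulVec_fderiv_fderiv_barrierSol (q : ParamQP n p ι) (hH : q.H.PosDef) {η : ℝ}
    (hη : 0 < η) {x : EuclideanSpace ℝ p} (hx : x ∈ q.solvable η) (y z : EuclideanSpace ℝ p) :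
    q.H *ᵥ (fderiv ℝ (fderiv ℝ (q.barrierSol η)) x y z).ofLp =
      q.Gᵀ *ᵥ (fun i => η / q.residual x (q.barrierSol η x) i ^ 2 *
        (-2 / q.residual x (q.barrierSol η x) i *
            ((q.P *ᵥ y.ofLp) i - (q.G *ᵥ (fderiv ℝ (q.barrierSol η) x y).ofLp) i) *
            ((q.P *ᵥ z.ofLp) i - (q.G *ᵥ (fderiv ℝ (q.barrierSol η) x z).ofLp) i) -
          (q.G *ᵥ (fderiv ℝ (fderiv ℝ (q.barrierSol η)) x y z).ofLp) i)) := by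
  obtain ⟨hcd, hev⟩ := q.contDiffAt_barrierSol hH hη hx
  have hX := hasDerivAt_add_smul x y 0
  have hx0 : x + (0 : ℝ) • y = x := by rw [zero_smul, add_zero]
  have hF : HasFDerivAt (q.barrierSol η) (fderiv ℝ (q.barrierSol η) x) (x + (0 : ℝ) • y) := by
    rw [hx0]
    exact (hcd.differentiableAt two_ne_zero).hasFDerivAt
  have hF2 : HasFDerivAt (fderiv ℝ (q.barrierSol η)) (fderiv ℝ (fderiv ℝ (q.barrierSol η)) x)
      (x + (0 : ℝ) • y) := by
    rw [hx0]
    exact ((hcd.fderiv_right (m := 1) (by norm_num)).differentiableAt one_ne_zero).hasFDerivAt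
  have hU := hF.comp_hasDerivAt (0 : ℝ) hX
  have hU2 : HasDerivAt (fun s : ℝ => fderiv ℝ (q.barrierSol η) (x + s • y) z)
      (fderiv ℝ (fderiv ℝ (q.barrierSol η)) x y z) 0 := by
    rw [hx0] at hF2
    exact hF2.hasDerivAt_line_apply y z
  have hpos : ∀ i, q.residual (x + (0 : ℝ) • y) (q.barrierSol η (x + (0 : ℝ) • y)) i ≠ 0 := by
    rw [hx0]
    exact fun i => ((barrierSol_spec hx).1 i).ne'
  have hrhs : HasDerivAt (fun s : ℝ => (fun i =>
      η / q.residual (x + s • y) (q.barrierSol η (x + s • y)) i ^ 2 *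
        ((q.P *ᵥ z.ofLp) i - (q.G *ᵥ (fderiv ℝ (q.barrierSol η) (x + s • y) z).ofLp) i))) _ 0 :=
    hasDerivAt_pi.2 fun i => ((hasDerivAt_const (0 : ℝ) η).fun_div
      ((q.hasDerivAt_residual hX hU i).fun_pow 2) (pow_ne_zero 2 (hpos i))).fun_mul
      ((hasDerivAt_pi.1 (hU2.ofLp.matrix_mulVec q.G) i).const_sub _)
  have h1 := hU2.ofLp.matrix_mulVec q.H
  have h2 := (hrhs.matrix_mulVec q.Gᵀ).const_add (q.Fᵀ *ᵥ z.ofLp)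
  refine (h1.unique (h2.congr_of_eventuallyEq ?_)).trans ?_
  -- The first-order equation holds for all parameters near `x`, so its two sides may be
  -- differentiated along the line in direction `y`.
  · filter_upwards [(tendsto_add_smul x y).eventually hev] with s hs
    exact q.mulVec_fderiv_barrierSol hH hη hs z
  congr 1
  ext i
  have hi := hpos i
  simp only [Function.comp_def, hx0] at hi ⊢
  field_simp
  ring

variable [DecidableEq p]

theorem norm_fderiv_barrierSol_le (q : ParamQP n p ι) (hH : q.H.PosDef) {η : ℝ}
    (hη : 0 < η) {x : EuclideanSpace ℝ p} (hx : x ∈ q.solvable η) :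
    ‖fderiv ℝ (q.barrierSol η) x‖ ≤ q.constL :=
  ContinuousLinearMap.opNorm_le_bound _ q.constL_nonneg fun z =>
    q.norm_le_constL hH (fun i => div_pos hη (pow_pos ((barrierSol_spec hx).1 i) 2)) _ z
      (q.mulVec_fderiv_barrierSol hH hη hx z)

theorem norm_residual_fderiv_le (q : ParamQP n p ι) (hH : q.H.PosDef) {η : ℝ}
    (hη : 0 < η) {x : EuclideanSpace ℝ p} (hx : x ∈ q.solvable η) (z : EuclideanSpace ℝ p) :
    ‖WithLp.toLp 2 (q.P *ᵥ z.ofLp - q.G *ᵥ (fderiv ℝ (q.barrierSol η) x z).ofLp)‖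
      ≤ (‖q.P‖ + ‖q.G‖ * q.constL) * ‖z‖ := by
  rw [WithLp.toLp_sub]
  refine (norm_sub_le _ _).trans ?_
  have h1 := Matrix.l2_opNorm_mulVec q.P z
  have h2 := Matrix.l2_opNorm_mulVec q.G (fderiv ℝ (q.barrierSol η) x z)
  have h3 := ContinuousLinearMap.le_of_opNorm_le _ (q.norm_fderiv_barrierSol_le hH hη hx) z
  have h4 := mul_le_mul_of_nonneg_left h3 (norm_nonneg q.G)
  calc _ ≤ ‖q.P‖ * ‖z‖ + ‖q.G‖ * (q.constL * ‖z‖) := add_le_add h1 (h2.trans h4)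
    _ = _ := by ring

omit [DecidableEq ι] in
theorem norm_le_mul_norm_of_abs_le {v w : EuclideanSpace ℝ ι} {K : ℝ} (hK : 0 ≤ K)
    (h : ∀ i, |v i| ≤ K * |w i|) : ‖v‖ ≤ K * ‖w‖ := by
  refine le_of_sq_le_sq ?_ (by positivity)
  rw [mul_pow, EuclideanSpace.norm_sq_eq, EuclideanSpace.norm_sq_eq, Finset.mul_sum]
  refine Finset.sum_le_sum fun i _ => ?_
  rw [← mul_pow]
  exact pow_le_pow_left₀ (norm_nonneg _) (h i) 2

/-- Rows with `G i = 0` have no residual bound, but `Gᵀ` discards their coordinates. The value `ρ =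
0` is admitted only when every row is zero; the data `v` then vanishes, in agreement with division
by zero giving `0`. -/
theorem norm_fderiv_fderiv_barrierSol_le (q : ParamQP n p ι) (hH : q.H.PosDef) {η ρ : ℝ}
    (hη : 0 < η) {x : EuclideanSpace ℝ p} (hx : x ∈ q.solvable η) (hρ0 : 0 ≤ ρ)
    (hρ : ∀ i, q.G i ≠ 0 → 0 < ρ ∧ ρ ≤ q.residual x (q.barrierSol η x) i) :
    ‖fderiv ℝ (fderiv ℝ (q.barrierSol η)) x‖
      ≤ q.constC / ρ * (‖q.P‖ + ‖q.G‖ * q.constL) ^ 2 := by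
  classical
  set a := ‖q.P‖ + ‖q.G‖ * q.constL with ha
  have ha0 : 0 ≤ a := add_nonneg (norm_nonneg _) (mul_nonneg (norm_nonneg _) q.constL_nonneg)
  have hC0 := q.constC_nonneg
  refine ContinuousLinearMap.opNorm_le_bound₂ _ (by positivity) fun y z => ?_
  set f : EuclideanSpace ℝ p → EuclideanSpace ℝ ι := fun z =>
    WithLp.toLp 2 (q.P *ᵥ z.ofLp - q.G *ᵥ (fderiv ℝ (q.barrierSol η) x z).ofLp) with hf
  have hfa : ∀ z, ‖f z‖ ≤ a * ‖z‖ := q.norm_residual_fderiv_le hH hη hx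
  -- The data of the second-derivative system, set to `0` on zero rows, where the residual may be
  -- arbitrarily small.
  set v : EuclideanSpace ℝ ι := WithLp.toLp 2 fun i => if q.G i = 0 then 0 else
    -2 / q.residual x (q.barrierSol η x) i * f y i * f z i with hv
  have hvn : ‖v‖ ≤ 2 / ρ * (a * ‖y‖) * ‖f z‖ := by
    refine norm_le_mul_norm_of_abs_le (by positivity) fun i => ?_
    by_cases hi : q.G i = 0
    · simp only [hv, hi, if_true, abs_zero]
      positivity
    · obtain ⟨h1, h2⟩ := hρ i hi
      simp only [hv, hi, if_false]
      rw [abs_mul, abs_mul, abs_div, abs_neg, abs_two, abs_of_pos (h1.trans_le h2)]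
      -- In the coordinatewise product, one factor is bounded entry by entry and the other is kept
      -- for the Euclidean norm, so no dimension factor appears.
      have h3 : |f y i| ≤ a * ‖y‖ := (PiLp.norm_apply_le (f y) i).trans (hfa y)
      gcongr
  have heq : q.H *ᵥ (fderiv ℝ (fderiv ℝ (q.barrierSol η)) x y z).ofLp = q.Gᵀ *ᵥ (fun i =>
      η / q.residual x (q.barrierSol η x) i ^ 2 *
        (v i - (q.G *ᵥ (fderiv ℝ (fderiv ℝ (q.barrierSol η)) x y z).ofLp) i)) := by
    rw [q.mulVec_fderiv_fderiv_barrierSol hH hη hx y z]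
    ext k
    simp only [Matrix.mulVec, dotProduct, Matrix.transpose_apply]
    refine Finset.sum_congr rfl fun i _ => ?_
    by_cases hi : q.G i = 0
    · simp [hi]
    · simp [hv, hi, hf, Matrix.mulVec, dotProduct]
  have h1 := q.two_mul_norm_le_constC hH
    (fun i => div_pos hη (pow_pos ((barrierSol_spec hx).1 i) 2)) _ v heq
  have h2 : q.constC * ‖v‖ ≤ q.constC * (2 / ρ * (a * ‖y‖) * (a * ‖z‖)) :=
    mul_le_mul_of_nonneg_left
      (hvn.trans (mul_le_mul_of_nonneg_left (hfa z) (by positivity))) hC0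
  have h3 : q.constC * (2 / ρ * (a * ‖y‖) * (a * ‖z‖))
      = 2 * (q.constC / ρ * a ^ 2 * ‖y‖ * ‖z‖) := by ring
  linarith

end Smoothness

end ParamQP

/-! ### Specialization to the condensed MPC problem -/

theorem Matrix.PosDef.blockDiagonal {m o : Type} [Fintype m] [Fintype o] [DecidableEq o]
    {N : o → Matrix m m ℝ} (hN : ∀ t, (N t).PosDef) : (Matrix.blockDiagonal N).PosDef := by
  refine Matrix.PosDef.of_dotProduct_mulVec_pos ?_ fun {x} hx => ?_
  · rw [Matrix.IsHermitian, Matrix.blockDiagonal_conjTranspose]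
    congr 1
    ext1 t
    exact (hN t).isHermitian.eq
  · have h1 : star x ⬝ᵥ (Matrix.blockDiagonal N *ᵥ x)
        = ∑ t, star (fun i => x (i, t)) ⬝ᵥ (N t *ᵥ fun i => x (i, t)) := by
      simp only [dotProduct, Matrix.mulVec, Fintype.sum_prod_type, Matrix.blockDiagonal_apply,
        star_trivial, ite_mul, zero_mul, Finset.sum_ite_eq, Finset.mem_univ, if_true]
      exact Finset.sum_comm
    rw [h1]
    obtain ⟨⟨i, t⟩, hit⟩ := Function.ne_iff.1 hx
    refine Finset.sum_pos' (fun s _ => (hN s).posSemidef.dotProduct_mulVec_nonneg _)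
      ⟨t, Finset.mem_univ t, (hN t).dotProduct_mulVec_pos fun h => hit (congrFun h i)⟩

namespace LinearMPC

variable {T dx du kx ku : ℕ}

theorem condensed_H_posDef (M : LinearMPC T dx du kx ku) (s : Constr T kx ku → ℝ) :
    (M.condensed s).H.PosDef := by
  have h := (Matrix.PosDef.blockDiagonal M.Q_posDef).posSemidef.conjTranspose_mul_mul_same M.Bhat
  rw [Matrix.conjTranspose_eq_transpose_of_trivial] at h
  exact ((Matrix.PosDef.blockDiagonal M.R_posDef).add_posSemidef h).smul two_pos

/-- The projection of an input sequence to its first input. -/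
def firstInput [NeZero T] :
    EuclideanSpace ℝ (Fin du × Fin T) →L[ℝ] EuclideanSpace ℝ (Fin du) :=
  LinearMap.toContinuousLinearMap
    { toFun := fun u => WithLp.toLp 2 fun j => u (j, 0)
      map_add' := fun _ _ => rfl
      map_smul' := fun _ _ => rfl }

theorem norm_firstInput_le [NeZero T] (u : EuclideanSpace ℝ (Fin du × Fin T)) :
    ‖firstInput u‖ ≤ ‖u‖ := by
  refine le_of_sq_le_sq ?_ (norm_nonneg _)
  rw [EuclideanSpace.norm_sq_eq, EuclideanSpace.norm_sq_eq, Fintype.sum_prod_type]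
  refine Finset.sum_le_sum fun j _ => ?_
  exact Finset.single_le_sum (f := fun t => ‖u (j, t)‖ ^ 2) (fun t _ => by positivity)
    (Finset.mem_univ 0)

end LinearMPC

end

theorem mainTheorem2 {T dx du kx ku : ℕ} [NeZero T] (M : LinearMPC T dx du kx ku)
    (s : LinearMPC.Constr T kx ku → ℝ) (hs : ∀ i, 0 < s i)
    (hrow : ∀ i, (M.condensed s).G i = 0 ∨ 1 ≤ ‖WithLp.toLp 2 ((M.condensed s).G i)‖)
    (η r R : ℝ) (LV : ℝ≥0) (hη : 0 < η) (hr : 0 < r)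
    (D : Set (EuclideanSpace ℝ (Fin dx))) (hD : Convex ℝ D)
    (hstrict : ∀ x ∈ D, ((M.condensed s).strictlyFeasible x).Nonempty)
    (hball : ∀ x ∈ D, ∃ c, Metric.closedBall c r ⊆ (M.condensed s).feasible x)
    (hR : ∀ x ∈ D, (M.condensed s).feasible x ⊆ Metric.closedBall 0 R)
    (hLip : ∀ x ∈ D,
      LipschitzOnWith LV ((M.condensed s).objective x) ((M.condensed s).feasible x)) :
    (∀ x ∈ D,
      (∃! u, (M.condensed s).IsBarrierMinimizer η x u) ∧
      (∀ i, (M.condensed s).G i ≠ 0 →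
        (M.condensed s).resLB η r R LV ≤
          (M.condensed s).residual x ((M.condensed s).barrierSol η x) i) ∧
      ContDiffAt ℝ 2 ((M.condensed s).barrierSol η) x ∧
      ‖fderiv ℝ (fderiv ℝ ((M.condensed s).barrierSol η)) x‖ ≤
        (M.condensed s).constC / (M.condensed s).resLB η r R LV *
          (‖(M.condensed s).P‖ + ‖(M.condensed s).G‖ * (M.condensed s).constL) ^ 2) ∧
    IsSmoothPolicyOn D (M.barrierPolicy s η) (M.condensed s).constL
      ((M.condensed s).constC / (M.condensed s).resLB η r R LV *
        (‖(M.condensed s).P‖ + ‖(M.condensed s).G‖ * (M.condensed s).constL) ^ 2) := by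
  have hH := M.condensed_H_posDef s
  set q := M.condensed s with hq
  have hsolv : ∀ x ∈ D, x ∈ q.solvable η := fun x hx =>
    q.exists_isBarrierMinimizer hη (hstrict x hx) (Metric.isBounded_closedBall.subset (hR x hx))
  have hres : ∀ x ∈ D, ∀ i, q.G i ≠ 0 →
      q.resLB η r R LV ≤ q.residual x (q.barrierSol η x) i := by
    intro x hx i hi
    obtain ⟨c, hc⟩ := hball x hx
    have hmin := ParamQP.barrierSol_spec (hsolv x hx)
    exact q.resLB_le_residual hH hη hr hc (hR x hx) (hLip x hx) hmin.1
      (hmin.gradCost_eq_zero hH.isHermitian) ((hrow i).resolve_left hi)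
  have hcd : ∀ x ∈ D, ContDiffAt ℝ 2 (q.barrierSol η) x := fun x hx =>
    (q.contDiffAt_barrierSol hH hη (hsolv x hx)).1
  have hd1 : ∀ x ∈ D, DifferentiableAt ℝ (q.barrierSol η) x := fun x hx =>
    (hcd x hx).differentiableAt two_ne_zero
  have hd2 : ∀ x ∈ D, DifferentiableAt ℝ (fderiv ℝ (q.barrierSol η)) x := fun x hx =>
    ((hcd x hx).fderiv_right (m := 1) (by norm_num)).differentiableAt one_ne_zero
  have hsecond : ∀ x ∈ D, ‖fderiv ℝ (fderiv ℝ (q.barrierSol η)) x‖ ≤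
      q.constC / q.resLB η r R LV * (‖q.P‖ + ‖q.G‖ * q.constL) ^ 2 := fun x hx =>
    q.norm_fderiv_fderiv_barrierSol_le hH hη (hsolv x hx) (q.resLB_nonneg hη hr R LV)
      -- Without constraints `res_lb` can be `0`; a nonzero row supplies the constraint that makes
      -- `ν`, hence `res_lb`, positive.
      fun i hi => ⟨haveI : Nonempty (LinearMPC.Constr T kx ku) := ⟨i⟩; q.resLB_pos hη hr R LV,
        hres x hx i hi⟩
  have hπ : M.barrierPolicy s η = LinearMPC.firstInput ∘ q.barrierSol η := rfl
  have hfd : ∀ x ∈ D, fderiv ℝ (M.barrierPolicy s η) x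
      = LinearMPC.firstInput ∘L fderiv ℝ (q.barrierSol η) x := fun x hx => by
    rw [hπ, fderiv_comp x LinearMPC.firstInput.differentiableAt (hd1 x hx),
      ContinuousLinearMap.fderiv]
  refine ⟨fun x hx => ⟨?_, hres x hx, hcd x hx, hsecond x hx⟩, fun x hx => ?_,
    fun x hx y hy => ⟨?_, ?_⟩⟩
  · have hmin := ParamQP.barrierSol_spec (hsolv x hx)
    exact ⟨_, hmin, (ParamQP.IsBarrierMinimizer.of_gradCost_eq_zero hH hη hmin.1
      (hmin.gradCost_eq_zero hH.isHermitian)).2⟩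
  · rw [hπ]
    exact LinearMPC.firstInput.differentiableAt.comp x (hd1 x hx)
  · rw [hπ, Function.comp_apply, Function.comp_apply, ← map_sub]
    -- Projecting to the first input does not increase norms, so the bounds on the full input
    -- sequence, integrated along segments in `D`, pass to the policy.
    exact (LinearMPC.norm_firstInput_le _).trans (hD.norm_image_sub_le_of_norm_fderiv_le hd1
      (fun z hz => q.norm_fderiv_barrierSol_le hH hη (hsolv z hz)) hy hx)
  · rw [hfd x hx, hfd y hy, ← ContinuousLinearMap.comp_sub]
    refine le_trans ?_ (hD.norm_image_sub_le_of_norm_fderiv_le hd2 hsecond hy hx)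
    refine ContinuousLinearMap.opNorm_le_bound _ (norm_nonneg _) fun z => ?_
    exact (LinearMPC.norm_firstInput_le _).trans (ContinuousLinearMap.le_opNorm _ z)
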